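/- Let $d\ge 1$, let $K\subset\overline{\mathbb Q}$ be a number field and let $F$ be a finite subset of $SL_d(K)$. For a place $v$ of $K$ let $K_v$ be the completion and $n_v=[K_v:\mathbb Q_v]$ its degree over the closure $\mathbb Q_v$ of $\mathbb Q$ in $K_v$, and let $|\cdot|_v$ be the absolute value on an algebraic closure $\overline{K_v}$ that extends the standard one on $\mathbb Q_v$ (so $|p|_v=1/p$ if $v\mid p$). Equip $\overline{K_v}^{\,d}$ with the sup norm if $v$ is finite and with the Euclidean norm if $v$ is infinite, let $\|\cdot\|_v$ be the associated operator norm on $M_d(\overline{K_v})$, and put $\|Q\|_v=\max_{q\in Q}\|q\|_v$ for a finite set $Q$ of matrices ($\|\emptyset\|_v=0$). Set $$E_v(F)=\inf_{x\in GL_d(\overline{K_v})}\|xFx^{-1}\|_v,\qquad R_v(F)=\lim_{n\to\infty}\|F^n\|_v^{1/n},$$ where $F^n$ is the set of all products of $n$ elements of $F$, and, with $\log^+=\max\{0,\log\}$ and $\log^+0=0$, define the minimal height and the normalized height of $F$ by $$e(F)=\frac1{[K:\mathbb Q]}\sum_v n_v\log^+E_v(F),\qquad \widehat h(F)=\frac1{[K:\mathbb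 Q]}\sum_v n_v\log^+R_v(F),$$ the sums being over all places of $K$. (These numbers do not depend on the choice of the number field $K$ with $F\subset SL_d(K)$.) **Proposition.** Let $d\ge 1$. For every $\varepsilon>0$ there is $\delta=\delta(d,\varepsilon)>0$ such that for every finite set $F\subset SL_d(\overline{\mathbb Q})$, with heights computed over any number field $K$ such that $F\subset SL_d(K)$: if $\widehat h(F)<\delta$, then $e(F)<\varepsilon$. Moreover, for every finite set $F\subset SL_d(\overline{\mathbb Q})$, $\widehat h(F)=0$ if and only if $e(F)=0$. -/

import Mathlib

open scoped Pointwise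

noncomputable section

namespace HeightGap

/-! ### Norms and spectral quantities over a field with an absolute value

`L` is a field (in the applications: an algebraically closed field) and `a : L → ℝ` is the
absolute value under consideration. -/

section Local

variable {L : Type*} [Field L] {d : ℕ}

/-- The sup norm `max_i |x_i|` on `L^d`. -/
def supNorm (a : L → ℝ) (x : Fin d → L) : ℝ := ⨆ i, a (x i)

/-- The Euclidean norm `√(∑_i |x_i|^2)` on `L^d`. -/
def euclNorm (a : L → ℝ) (x : Fin d → L) : ℝ := √(∑ i, a (x i) ^ 2)

/-- The operator norm of a matrix, relative to the norm `ν` on `L^d`. -/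
def opNorm (ν : (Fin d → L) → ℝ) (A : Matrix (Fin d) (Fin d) L) : ℝ :=
  sInf {c : ℝ | 0 ≤ c ∧ ∀ x, ν (A.mulVec x) ≤ c * ν x}

/-- `‖Q‖ = sup_{q ∈ Q} ‖q‖` for a set `Q` of matrices. -/
def setNorm (ν : (Fin d → L) → ℝ) (Q : Set (Matrix (Fin d) (Fin d) L)) : ℝ :=
  sSup (opNorm ν '' Q)

/-- The conjugate `x Q x⁻¹` of a set of matrices. -/
def conjSet (x : GL (Fin d) L) (Q : Set (Matrix (Fin d) (Fin d) L)) :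
    Set (Matrix (Fin d) (Fin d) L) :=
  (fun q => (x : Matrix (Fin d) (Fin d) L) * q *
    ((x⁻¹ : GL (Fin d) L) : Matrix (Fin d) (Fin d) L)) '' Q

/-- The minimal norm `E(Q) = inf_{x ∈ GL_d(L)} ‖x Q x⁻¹‖`. -/
def minimalNorm (ν : (Fin d → L) → ℝ) (Q : Set (Matrix (Fin d) (Fin d) L)) : ℝ :=
  ⨅ x : GL (Fin d) L, setNorm ν (conjSet x Q)

/-- The (joint) spectral radius `R(Q) = lim_n ‖Q^n‖^{1/n}`, where `Q^n` is the set of all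
products of `n` elements of `Q`. The limit exists for bounded `Q`, by submultiplicativity. -/
def jointSpectralRadius (ν : (Fin d → L) → ℝ) (Q : Set (Matrix (Fin d) (Fin d) L)) : ℝ :=
  Filter.limUnder Filter.atTop (fun n : ℕ => setNorm ν (Q ^ n) ^ (1 / (n : ℝ)))

end Local

/-! ### Places of a number field -/

section Places

open NumberField IsDedekindDomain

variable (K : Type*) [Field K] [NumberField K]

/-- The closure of `ℚ` in the completion `K_v` at a finite place `v`, a copy of `ℚ_p`. -/
def rationalClosure (v : HeightOneSpectrum (𝓞 K)) : Subfield (v.adicCompletion K) :=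
  (⊥ : Subfield (v.adicCompletion K)).topologicalClosure

/-- The local degree `n_v = [K_v : ℚ_p]` at a finite place. -/
def localDegree (v : HeightOneSpectrum (𝓞 K)) : ℕ :=
  Module.finrank (rationalClosure K v) (v.adicCompletion K)

/-- An algebraic closure of the completion `K_v` at a finite place. -/
abbrev CompletionClosure (v : HeightOneSpectrum (𝓞 K)) : Type _ :=
  AlgebraicClosure (v.adicCompletion K)

/-- The absolute value `|·|_v` on the algebraic closure of `K_v`, extending the standard one on
`ℚ_p` (`|p|_v = 1 / p`). Mathlib's norm on `K_v` is `|·|_v ^ n_v`, i.e. a uniformizer has norm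
`1 / N(v)`; the spectral norm is its unique extension to the algebraic closure. -/
def finiteAbs (v : HeightOneSpectrum (𝓞 K)) (x : CompletionClosure K v) : ℝ :=
  spectralNorm (v.adicCompletion K) (CompletionClosure K v) x ^ (1 / (localDegree K v : ℝ))

/-- The embedding of `K` in the algebraic closure of `K_v`. -/
def finiteEmbedding (v : HeightOneSpectrum (𝓞 K)) : K →+* CompletionClosure K v :=
  (algebraMap (v.adicCompletion K) (CompletionClosure K v)).comp (FinitePlace.embedding v)

end Places

/-! ### Heights of finite sets of matrices over a number field -/

section Heights

open NumberField IsDedekindDomain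

variable {K : Type*} [Field K] [NumberField K] {d : ℕ}

/-- The image of a set of matrices under a field embedding applied to the entries. -/
def mapSet {L : Type*} [Field L] (σ : K →+* L) (F : Set (Matrix (Fin d) (Fin d) K)) :
    Set (Matrix (Fin d) (Fin d) L) :=
  (fun A => A.map σ) '' F

/-- `E_v(F)` at an infinite place; the algebraic closure of `K_v` is identified with `ℂ`. -/
def minimalNormInfinite (v : InfinitePlace K) (F : Set (Matrix (Fin d) (Fin d) K)) : ℝ :=
  minimalNorm (euclNorm (fun z : ℂ => ‖z‖)) (mapSet v.embedding F)

/-- `E_v(F)` at a finite place. -/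
def minimalNormFinite (v : HeightOneSpectrum (𝓞 K)) (F : Set (Matrix (Fin d) (Fin d) K)) : ℝ :=
  minimalNorm (supNorm (finiteAbs K v)) (mapSet (finiteEmbedding K v) F)

/-- `R_v(F)` at an infinite place. -/
def spectralRadiusInfinite (v : InfinitePlace K) (F : Set (Matrix (Fin d) (Fin d) K)) : ℝ :=
  jointSpectralRadius (euclNorm (fun z : ℂ => ‖z‖)) (mapSet v.embedding F)

/-- `R_v(F)` at a finite place. -/
def spectralRadiusFinite (v : HeightOneSpectrum (𝓞 K)) (F : Set (Matrix (Fin d) (Fin d) K)) : ℝ :=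
  jointSpectralRadius (supNorm (finiteAbs K v)) (mapSet (finiteEmbedding K v) F)

/-- The minimal height `e(F) = [K : ℚ]⁻¹ ∑_v n_v log⁺ E_v(F)`. -/
def minimalHeight (F : Set (Matrix (Fin d) (Fin d) K)) : ℝ :=
  (1 / (Module.finrank ℚ K : ℝ)) *
    ((∑ v : InfinitePlace K, (v.mult : ℝ) * Real.posLog (minimalNormInfinite v F)) +
      ∑ᶠ v : HeightOneSpectrum (𝓞 K),
        (localDegree K v : ℝ) * Real.posLog (minimalNormFinite v F))

/-- The normalized height `ĥ(F) = [K : ℚ]⁻¹ ∑_v n_v log⁺ R_v(F)`. -/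
def normalizedHeight (F : Set (Matrix (Fin d) (Fin d) K)) : ℝ :=
  (1 / (Module.finrank ℚ K : ℝ)) *
    ((∑ v : InfinitePlace K, (v.mult : ℝ) * Real.posLog (spectralRadiusInfinite v F)) +
      ∑ᶠ v : HeightOneSpectrum (𝓞 K),
        (localDegree K v : ℝ) * Real.posLog (spectralRadiusFinite v F))

end Heights

/-- The field of algebraic numbers. -/
abbrev Qbar : Type := AlgebraicClosure ℚ

/-- `F ⊂ SL_d(K)`, for a set `F` in `SL_d` of the algebraic numbers and a subfield `K`. -/
def DefinedOver {d : ℕ} (K : IntermediateField ℚ Qbar)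
    (F : Set (Matrix.SpecialLinearGroup (Fin d) Qbar)) : Prop :=
  ∀ g ∈ F, ∀ i j, (g : Matrix (Fin d) (Fin d) Qbar) i j ∈ K

/-- A set `F ⊂ SL_d(K)` of matrices with algebraic entries, viewed as a set of matrices over
`K`. -/
def overField {d : ℕ} (K : IntermediateField ℚ Qbar)
    (F : Set (Matrix.SpecialLinearGroup (Fin d) Qbar)) : Set (Matrix (Fin d) (Fin d) K) :=
  {A | ∃ g ∈ F, A.map (algebraMap K Qbar) = (g : Matrix (Fin d) (Fin d) Qbar)}

end HeightGap

end

noncomputable section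

namespace HeightGap

/-! ### Norms over a valued field -/

/-! The heights are compared place by place. `R_v ≤ E_v` is elementary
(`jointSpectralRadius_le_minimalNorm`), so the issue is to bound `E_v` above by `R_v`. For `c > R_v`
the norm `N_c(x) = sup c⁻ⁿ|p x|`, over products `p` of `n` elements, is finite, and every `q ∈ Q`
has operator norm at most `c` for it. To conjugate `Q` into small matrices for the standard norm,
`N_c` is replaced by a standard norm in other coordinates: among the matrices `T` mapping the
standard unit ball into that of `N_c`, take one with almost maximal `|det T|` (a John ellipsoid),
and compare it with the competitor `c⁻¹ q T`.

At a finite place these `T` are stable under addition, and Cramer's rule bounds the entries of `T⁻¹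
q T`; in the limit `log⁺ E_v = log⁺ R_v`, with no loss (`posLog_minimalNorm_le_of_nonarchimedean`).

At an infinite place the John ellipsoid alone would lose a factor depending on `d`. But `det q = 1`,
so `c⁻¹ q T` is almost maximal too when `c` is near 1, and strict log-concavity of the determinant
(uniqueness of the John ellipsoid) forces the singular values of `c⁻¹ T⁻¹ q T` to be close to 1.
Quantitatively, `log⁺ E_v ≤ η + N log⁺ R_v` with `N` depending only on `d` and `η`
(`exists_posLog_minimalNorm_le`).

Since the local degrees at infinity add up to `[K : ℚ]`, summing gives `ĥ ≤ e ≤ η + C ĥ` with `C`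
independent of `K` and `F`, and both assertions follow. -/

/-- `ν` is a norm on `L^d` over the absolute value `a`, which dominates the coordinates and for
which the standard basis vectors have norm one. -/
structure IsAbsNorm {L : Type*} [Field L] {d : ℕ} (a : AbsoluteValue L ℝ)
    (ν : (Fin d → L) → ℝ) : Prop where
  add_le : ∀ x y, ν (x + y) ≤ ν x + ν y
  smul : ∀ (c : L) x, ν (c • x) = a c * ν x
  single : ∀ i, ν (Pi.single i 1) = 1
  apply_le : ∀ x i, a (x i) ≤ ν x
  nonneg : ∀ x, 0 ≤ ν x

section Generic

variable {L : Type*} [Field L] {d : ℕ} {a : AbsoluteValue L ℝ} {ν : (Fin d → L) → ℝ}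

namespace IsAbsNorm

lemma zero (h : IsAbsNorm a ν) : ν 0 = 0 := by
  simpa using h.smul 0 0

lemma sum_le (h : IsAbsNorm a ν) {ι : Type*} (s : Finset ι) (f : ι → Fin d → L) :
    ν (∑ i ∈ s, f i) ≤ ∑ i ∈ s, ν (f i) := by
  classical
  induction s using Finset.induction_on with
  | empty => simp [h.zero]
  | insert i s hi ih =>
    rw [Finset.sum_insert hi, Finset.sum_insert hi]
    exact (h.add_le _ _).trans (by gcongr)

lemma mulVec_le (h : IsAbsNorm a ν) (A : Matrix (Fin d) (Fin d) L) (x : Fin d → L) :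
    ν (A.mulVec x) ≤ (∑ j, ν (A.col j)) * ν x := by
  rw [Matrix.mulVec_eq_sum, Finset.sum_mul]
  refine (h.sum_le _ _).trans (Finset.sum_le_sum fun j _ => ?_)
  rw [op_smul_eq_smul, h.smul, mul_comm]
  exact mul_le_mul_of_nonneg_left (h.apply_le x j) (h.nonneg _)

lemma opNorm_set_nonempty (h : IsAbsNorm a ν) (A : Matrix (Fin d) (Fin d) L) :
    {c : ℝ | 0 ≤ c ∧ ∀ x, ν (A.mulVec x) ≤ c * ν x}.Nonempty :=
  ⟨∑ j, ν (A.col j), Finset.sum_nonneg fun _ _ => h.nonneg _, h.mulVec_le A⟩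

lemma le_opNorm (h : IsAbsNorm a ν) (A : Matrix (Fin d) (Fin d) L) (x : Fin d → L) :
    ν (A.mulVec x) ≤ opNorm ν A * ν x := by
  rcases (h.nonneg x).eq_or_lt with hx | hx
  · simpa [← hx] using h.mulVec_le A x
  · rw [← div_le_iff₀ hx]
    refine le_csInf (h.opNorm_set_nonempty A) fun c hc => ?_
    rw [div_le_iff₀ hx]
    exact hc.2 x

end IsAbsNorm

lemma opNorm_nonneg (ν : (Fin d → L) → ℝ) (A : Matrix (Fin d) (Fin d) L) : 0 ≤ opNorm ν A :=
  Real.sInf_nonneg fun _ hc => hc.1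

lemma opNorm_le {A : Matrix (Fin d) (Fin d) L} {c : ℝ} (hc : 0 ≤ c)
    (h : ∀ x, ν (A.mulVec x) ≤ c * ν x) : opNorm ν A ≤ c :=
  csInf_le ⟨0, fun _ hc => hc.1⟩ ⟨hc, h⟩

lemma IsAbsNorm.opNorm_mul_le (h : IsAbsNorm a ν) (A B : Matrix (Fin d) (Fin d) L) :
    opNorm ν (A * B) ≤ opNorm ν A * opNorm ν B := by
  refine opNorm_le (mul_nonneg (opNorm_nonneg _ _) (opNorm_nonneg _ _)) fun x => ?_
  rw [← Matrix.mulVec_mulVec, mul_assoc]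
  exact (h.le_opNorm _ _).trans
    (mul_le_mul_of_nonneg_left (h.le_opNorm _ _) (opNorm_nonneg _ _))

lemma IsAbsNorm.one_le_opNorm_one (h : IsAbsNorm a ν) (hd : 1 ≤ d) :
    1 ≤ opNorm ν (1 : Matrix (Fin d) (Fin d) L) := by
  have := h.le_opNorm 1 (Pi.single ⟨0, hd⟩ 1)
  rwa [Matrix.one_mulVec, h.single, mul_one] at this

lemma opNorm_one_le (ν : (Fin d → L) → ℝ) : opNorm ν (1 : Matrix (Fin d) (Fin d) L) ≤ 1 :=
  opNorm_le zero_le_one (by simp)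

lemma setNorm_nonneg (ν : (Fin d → L) → ℝ) (Q : Set (Matrix (Fin d) (Fin d) L)) :
    0 ≤ setNorm ν Q :=
  Real.sSup_nonneg (by rintro _ ⟨q, -, rfl⟩; exact opNorm_nonneg _ _)

variable {Q : Set (Matrix (Fin d) (Fin d) L)}

lemma opNorm_le_setNorm (hQ : Q.Finite) {q : Matrix (Fin d) (Fin d) L} (hq : q ∈ Q) :
    opNorm ν q ≤ setNorm ν Q :=
  le_csSup (hQ.image _).bddAbove ⟨q, hq, rfl⟩

lemma setNorm_le {c : ℝ} (hc : 0 ≤ c) (h : ∀ q ∈ Q, opNorm ν q ≤ c) : setNorm ν Q ≤ c :=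
  Real.sSup_le (by rintro _ ⟨q, hq, rfl⟩; exact h q hq) hc

lemma IsAbsNorm.setNorm_mul_le (h : IsAbsNorm a ν) {P : Set (Matrix (Fin d) (Fin d) L)}
    (hP : P.Finite) (hQ : Q.Finite) : setNorm ν (P * Q) ≤ setNorm ν P * setNorm ν Q := by
  refine setNorm_le (mul_nonneg (setNorm_nonneg _ _) (setNorm_nonneg _ _)) ?_
  rintro _ ⟨p, hp, q, hq, rfl⟩
  exact (h.opNorm_mul_le p q).trans (mul_le_mul (opNorm_le_setNorm hP hp)
    (opNorm_le_setNorm hQ hq) (opNorm_nonneg _ _) (setNorm_nonneg _ _))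

lemma finite_pow (hQ : Q.Finite) (n : ℕ) : (Q ^ n).Finite := by
  induction n with
  | zero => simp
  | succ n ih => rw [pow_succ]; exact ih.mul hQ

lemma setNorm_empty (ν : (Fin d → L) → ℝ) : setNorm ν (∅ : Set (Matrix (Fin d) (Fin d) L)) = 0 := by
  simp [setNorm]

lemma minimalNorm_nonneg (ν : (Fin d → L) → ℝ) (Q : Set (Matrix (Fin d) (Fin d) L)) :
    0 ≤ minimalNorm ν Q :=
  Real.iInf_nonneg fun _ => setNorm_nonneg _ _

lemma minimalNorm_le (ν : (Fin d → L) → ℝ) (Q : Set (Matrix (Fin d) (Fin d) L))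
    (x : GL (Fin d) L) : minimalNorm ν Q ≤ setNorm ν (conjSet x Q) :=
  ciInf_le ⟨0, by rintro _ ⟨y, rfl⟩; exact setNorm_nonneg _ _⟩ x

/-- A power of an invertible element of `Q` gives an exponential lower bound for `‖Q^n‖`. -/
lemma IsAbsNorm.one_le_setNorm_pow_mul (h : IsAbsNorm a ν) (hd : 1 ≤ d) (hQ : Q.Finite)
    {g g' : Matrix (Fin d) (Fin d) L} (hg : g ∈ Q) (hgg' : g * g' = 1) (n : ℕ) :
    1 ≤ setNorm ν (Q ^ n) * opNorm ν g' ^ n := by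
  have key : ∀ n : ℕ, opNorm ν (g' ^ n) ≤ opNorm ν g' ^ n := by
    intro n
    induction n with
    | zero => simpa using opNorm_one_le ν
    | succ n ih =>
      rw [pow_succ, pow_succ]
      exact (h.opNorm_mul_le _ _).trans (mul_le_mul_of_nonneg_right ih (opNorm_nonneg _ _))
  have hc : Commute g g' := by rw [commute_iff_eq, hgg', mul_eq_one_comm.mp hgg']
  calc 1 ≤ opNorm ν (1 : Matrix (Fin d) (Fin d) L) := h.one_le_opNorm_one hd
    _ = opNorm ν (g ^ n * g' ^ n) := by rw [← hc.mul_pow, hgg', one_pow]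
    _ ≤ opNorm ν (g ^ n) * opNorm ν (g' ^ n) := h.opNorm_mul_le _ _
    _ ≤ _ := mul_le_mul (opNorm_le_setNorm (finite_pow hQ n) (Set.pow_mem_pow hg)) (key n)
      (opNorm_nonneg _ _) (setNorm_nonneg _ _)

/-- The limit defining the joint spectral radius exists. -/
theorem IsAbsNorm.tendsto_jointSpectralRadius (h : IsAbsNorm a ν) (hd : 1 ≤ d) (hQ : Q.Finite)
    (hdet : ∀ q ∈ Q, q.det = 1) :
    Filter.Tendsto (fun n : ℕ => setNorm ν (Q ^ n) ^ (1 / (n : ℝ))) Filter.atTop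
      (nhds (jointSpectralRadius ν Q)) := by
  refine tendsto_nhds_limUnder ?_
  rcases Q.eq_empty_or_nonempty with rfl | ⟨g, hg⟩
  -- The power with `n = 0` is `{1}` even for empty `Q`, so the sequence is only eventually zero.
  · refine ⟨0, tendsto_const_nhds.congr' ?_⟩
    filter_upwards [Filter.eventually_gt_atTop 0] with n hn
    rw [Set.empty_pow hn.ne', setNorm_empty, Real.zero_rpow (by positivity)]
  · have hgg' : g * g⁻¹ = 1 := Matrix.mul_nonsing_inv g (by rw [hdet g hg]; exact isUnit_one)
    have hlow := h.one_le_setNorm_pow_mul hd hQ hg hgg'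
    have hpos : ∀ n, 0 < setNorm ν (Q ^ n) := fun n => by
      refine (setNorm_nonneg _ _).lt_of_ne fun h0 => ?_
      have := hlow n
      rw [← h0, zero_mul] at this
      exact absurd this (by norm_num)
    have hpos' : 0 < opNorm ν g⁻¹ := by
      refine (opNorm_nonneg _ _).lt_of_ne fun h0 => ?_
      have := hlow 1
      rw [← h0] at this
      norm_num at this
    -- Fekete's lemma applies to the logarithms; the invertible element `g` keeps them finite and
    -- their averages bounded below.
    have hsub : Subadditive fun n => Real.log (setNorm ν (Q ^ n)) := fun m n => by
      rw [← Real.log_mul (hpos m).ne' (hpos n).ne']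
      refine Real.log_le_log (hpos _) ?_
      rw [pow_add]
      exact (h.setNorm_mul_le (finite_pow hQ m) (finite_pow hQ n))
    have hbdd : BddBelow (Set.range fun n : ℕ => Real.log (setNorm ν (Q ^ n)) / n) := by
      refine ⟨-|Real.log (opNorm ν g⁻¹)|, ?_⟩
      rintro _ ⟨n, rfl⟩
      rcases n.eq_zero_or_pos with rfl | hn
      · simp
      · have hn' : (0 : ℝ) < n := by exact_mod_cast hn
        have := Real.log_nonneg (hlow n)
        rw [Real.log_mul (hpos n).ne' (pow_pos hpos' n).ne', Real.log_pow] at this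
        simp only
        rw [le_div_iff₀ hn']
        nlinarith [le_abs_self (Real.log (opNorm ν g⁻¹))]
    refine ⟨_, ((Real.continuous_exp.tendsto _).comp (hsub.tendsto_lim hbdd)).congr fun n => ?_⟩
    rw [Function.comp_apply, Real.rpow_def_of_pos (hpos n), mul_one_div]

lemma IsAbsNorm.jointSpectralRadius_nonneg (h : IsAbsNorm a ν) (hd : 1 ≤ d) (hQ : Q.Finite)
    (hdet : ∀ q ∈ Q, q.det = 1) : 0 ≤ jointSpectralRadius ν Q :=
  ge_of_tendsto' (h.tendsto_jointSpectralRadius hd hQ hdet) fun _ =>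
    Real.rpow_nonneg (setNorm_nonneg _ _) _

lemma IsAbsNorm.opNorm_conj_pow_le (h : IsAbsNorm a ν) (hQ : Q.Finite) (x : GL (Fin d) L) (n : ℕ) :
    ∀ p ∈ Q ^ n, opNorm ν ((x : Matrix (Fin d) (Fin d) L) * p *
      ((x⁻¹ : GL (Fin d) L) : Matrix (Fin d) (Fin d) L)) ≤ setNorm ν (conjSet x Q) ^ n := by
  induction n with
  | zero =>
    intro p hp
    rw [pow_zero, Set.mem_one] at hp
    simpa [hp] using opNorm_one_le ν
  | succ n ih =>
    intro p hp
    rw [pow_succ] at hp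
    obtain ⟨r, hr, q, hq, rfl⟩ := hp
    have : (x : Matrix (Fin d) (Fin d) L) * (r * q) *
        ((x⁻¹ : GL (Fin d) L) : Matrix (Fin d) (Fin d) L) =
        ((x : Matrix (Fin d) (Fin d) L) * r * ((x⁻¹ : GL (Fin d) L) : Matrix (Fin d) (Fin d) L)) *
          ((x : Matrix (Fin d) (Fin d) L) * q *
            ((x⁻¹ : GL (Fin d) L) : Matrix (Fin d) (Fin d) L)) := by
      simp only [Matrix.mul_assoc, Units.inv_mul_cancel_left]
    simp only [this, pow_succ]
    exact (h.opNorm_mul_le _ _).trans (mul_le_mul (ih r hr)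
      (opNorm_le_setNorm (hQ.image _) ⟨q, hq, rfl⟩) (opNorm_nonneg _ _)
      (pow_nonneg (setNorm_nonneg _ _) _))

/-- The joint spectral radius is at most the minimal norm. -/
theorem IsAbsNorm.jointSpectralRadius_le_minimalNorm (h : IsAbsNorm a ν) (hd : 1 ≤ d)
    (hQ : Q.Finite) (hdet : ∀ q ∈ Q, q.det = 1) :
    jointSpectralRadius ν Q ≤ minimalNorm ν Q := by
  refine le_ciInf fun x => ?_
  set s := setNorm ν (conjSet x Q)
  have hs : 0 ≤ s := setNorm_nonneg _ _
  set x' := ((x⁻¹ : GL (Fin d) L) : Matrix (Fin d) (Fin d) L)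
  set M := opNorm ν x' * opNorm ν (x : Matrix (Fin d) (Fin d) L)
  have hM : 0 ≤ M := mul_nonneg (opNorm_nonneg _ _) (opNorm_nonneg _ _)
  -- Undoing the conjugation costs a factor independent of `n`, which the `n`-th root removes. `M +
  -- 1` replaces `M` to have a positive base.
  have hle : ∀ n, setNorm ν (Q ^ n) ≤ (M + 1) * s ^ n := fun n => by
    refine setNorm_le (by positivity) fun p hp => ?_
    have hp' : p = x' * (x * p * x') * x := by
      simp only [x', Matrix.mul_assoc, Units.inv_mul_cancel_left, Units.inv_mul, Matrix.mul_one]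
    calc opNorm ν p ≤ opNorm ν x' * opNorm ν (x * p * x') * opNorm ν (x : Matrix _ _ L) := by
          conv_lhs => rw [hp']
          exact (h.opNorm_mul_le _ _).trans
            (mul_le_mul_of_nonneg_right (h.opNorm_mul_le _ _) (opNorm_nonneg _ _))
      _ = M * opNorm ν (x * p * x') := by ring
      _ ≤ (M + 1) * s ^ n := mul_le_mul (by linarith) (h.opNorm_conj_pow_le hQ x n p hp)
          (opNorm_nonneg _ _) (by positivity)
  have hlim : Filter.Tendsto (fun n : ℕ => (M + 1) ^ (1 / (n : ℝ)) * s) Filter.atTop (nhds s) := by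
    have h1 : Filter.Tendsto (fun n : ℕ => (M + 1) ^ (1 / (n : ℝ))) Filter.atTop
        (nhds ((M + 1) ^ (0 : ℝ))) :=
      (Real.continuousAt_const_rpow (by positivity)).tendsto.comp tendsto_one_div_atTop_nhds_zero_nat
    simpa using h1.mul_const s
  refine le_of_tendsto_of_tendsto (h.tendsto_jointSpectralRadius hd hQ hdet) hlim ?_
  filter_upwards [Filter.eventually_gt_atTop 0] with n hn
  calc setNorm ν (Q ^ n) ^ (1 / (n : ℝ)) ≤ ((M + 1) * s ^ n) ^ (1 / (n : ℝ)) :=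
        Real.rpow_le_rpow (setNorm_nonneg _ _) (hle n) (by positivity)
    _ = (M + 1) ^ (1 / (n : ℝ)) * s := by
        rw [Real.mul_rpow (by positivity) (by positivity), one_div,
          Real.pow_rpow_inv_natCast hs hn.ne']

/-- The ratio `‖Qⁿ‖ / cⁿ` is eventually at most 1, and `M` absorbs the finitely many other terms.
This is the finiteness of the norm `N_c`. -/
lemma IsAbsNorm.exists_setNorm_pow_le (h : IsAbsNorm a ν) (hd : 1 ≤ d) (hQ : Q.Finite)
    (hdet : ∀ q ∈ Q, q.det = 1) {c : ℝ} (hc : jointSpectralRadius ν Q < c) :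
    ∃ M : ℝ, 0 < M ∧ ∀ n, setNorm ν (Q ^ n) ≤ M * c ^ n := by
  have hc0 : 0 < c := (h.jointSpectralRadius_nonneg hd hQ hdet).trans_lt hc
  have hev : ∀ᶠ n : ℕ in Filter.atTop, setNorm ν (Q ^ n) / c ^ n ≤ 1 := by
    filter_upwards [(h.tendsto_jointSpectralRadius hd hQ hdet).eventually_lt_const hc,
      Filter.eventually_gt_atTop 0] with n hn hn0
    rw [div_le_one (by positivity)]
    calc setNorm ν (Q ^ n) = (setNorm ν (Q ^ n) ^ (1 / (n : ℝ))) ^ n := by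
          rw [one_div, Real.rpow_inv_natCast_pow (setNorm_nonneg _ _) hn0.ne']
      _ ≤ c ^ n := pow_le_pow_left₀ (Real.rpow_nonneg (setNorm_nonneg _ _) _) hn.le n
  obtain ⟨M, hM⟩ := (Filter.isBoundedUnder_of_eventually_le hev).bddAbove_range
  refine ⟨max M 1, by positivity, fun n => ?_⟩
  have := (hM ⟨n, rfl⟩).trans (le_max_left M 1)
  rwa [div_le_iff₀ (by positivity)] at this

/-! ### Matrices adapted to a set of matrices -/

/-- The matrices `T` with `|p T x| ≤ c^n |x|` for all products `p` of `n` elements of `Q`: those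
mapping the unit ball of `ν` into the unit ball of the norm `sup_{n, p} c^{-n} |p x|`. -/
def adapted (ν : (Fin d → L) → ℝ) (Q : Set (Matrix (Fin d) (Fin d) L)) (c : ℝ) :
    Set (Matrix (Fin d) (Fin d) L) :=
  {T | ∀ n, ∀ p ∈ Q ^ n, ∀ x, ν ((p * T).mulVec x) ≤ c ^ n * ν x}

lemma adapted_mul_right {c : ℝ} (hc : 0 ≤ c) {T U : Matrix (Fin d) (Fin d) L}
    (hT : T ∈ adapted ν Q c) (hU : ∀ x, ν (U.mulVec x) ≤ ν x) : T * U ∈ adapted ν Q c := by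
  intro n p hp x
  rw [← Matrix.mul_assoc, ← Matrix.mulVec_mulVec]
  exact (hT n p hp _).trans (mul_le_mul_of_nonneg_left (hU x) (pow_nonneg hc n))

/-- A product of `n` elements followed by `q` is a product of `n + 1` elements, so `q` stretches the
norm `N_c` by at most `c`, which `μ` compensates. -/
lemma IsAbsNorm.adapted_smul_mul (h : IsAbsNorm a ν) {c : ℝ} {T q : Matrix (Fin d) (Fin d) L}
    (hT : T ∈ adapted ν Q c) (hq : q ∈ Q) {μ : L} (hμ : a μ * c = 1) :
    μ • (q * T) ∈ adapted ν Q c := by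
  intro n p hp x
  have h1 := hT (n + 1) (p * q) (by rw [pow_succ]; exact Set.mul_mem_mul hp hq) x
  rw [Matrix.mul_smul, Matrix.smul_mulVec, h.smul, ← Matrix.mul_assoc]
  calc a μ * ν ((p * q * T).mulVec x) ≤ a μ * (c ^ (n + 1) * ν x) :=
        mul_le_mul_of_nonneg_left h1 (a.nonneg _)
    _ = (a μ * c) * (c ^ n * ν x) := by ring
    _ = c ^ n * ν x := by rw [hμ, one_mul]

lemma IsAbsNorm.exists_adapted (h : IsAbsNorm a ν) (hd : 1 ≤ d) (hQ : Q.Finite)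
    (hdet : ∀ q ∈ Q, q.det = 1) {c : ℝ} (hc : jointSpectralRadius ν Q < c)
    (ha : ∀ ε : ℝ, 0 < ε → ∃ μ : L, μ ≠ 0 ∧ a μ ≤ ε) :
    ∃ T ∈ adapted ν Q c, T.det ≠ 0 := by
  have hc0 : 0 < c := (h.jointSpectralRadius_nonneg hd hQ hdet).trans_lt hc
  obtain ⟨M, hM0, hM⟩ := h.exists_setNorm_pow_le hd hQ hdet hc
  obtain ⟨μ, hμ0, hμ⟩ := ha M⁻¹ (by positivity)
  refine ⟨μ • 1, fun n p hp x => ?_, by simp [hμ0]⟩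
  rw [Matrix.mul_smul, Matrix.mul_one, Matrix.smul_mulVec, h.smul]
  calc a μ * ν (p.mulVec x) ≤ M⁻¹ * ((M * c ^ n) * ν x) := by
        refine mul_le_mul hμ ((h.le_opNorm p x).trans ?_) (h.nonneg _) (by positivity)
        exact mul_le_mul_of_nonneg_right ((opNorm_le_setNorm (finite_pow hQ n) hp).trans (hM n))
          (h.nonneg _)
    _ = c ^ n * ν x := by field_simp

/-- There are adapted matrices whose determinant is maximal up to a factor close to one. -/
theorem IsAbsNorm.exists_adapted_almost_maximal (h : IsAbsNorm a ν) (hd : 1 ≤ d) (hQ : Q.Finite)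
    (hdet : ∀ q ∈ Q, q.det = 1) {c : ℝ} (hc : jointSpectralRadius ν Q < c)
    (ha : ∀ ε : ℝ, 0 < ε → ∃ μ : L, μ ≠ 0 ∧ a μ ≤ ε) {t : ℝ} (ht : 1 < t) :
    ∃ T ∈ adapted ν Q c, T.det ≠ 0 ∧ ∀ T' ∈ adapted ν Q c, a T'.det ≤ t * a T.det := by
  obtain ⟨T₀, hT₀, hT₀'⟩ := h.exists_adapted hd hQ hdet hc ha
  set S := (fun T : Matrix (Fin d) (Fin d) L => a T.det) '' adapted ν Q c
  have hbdd : BddAbove S := by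
    -- The condition for `n = 0` says that `T` itself does not increase `ν`, so its entries have
    -- absolute value at most 1.
    refine ⟨(Fintype.card (Fin d)).factorial • (1 : ℝ) ^ Fintype.card (Fin d), ?_⟩
    rintro _ ⟨T, hT, rfl⟩
    refine Matrix.det_le fun i j => ?_
    have := hT 0 1 (by simp) (Pi.single j 1)
    rw [Matrix.one_mul, h.single, Matrix.mulVec_single_one] at this
    simpa using (h.apply_le _ i).trans this
  have hpos : 0 < sSup S := (a.pos hT₀').trans_le (le_csSup hbdd ⟨T₀, hT₀, rfl⟩)
  -- Without local compactness the supremum need not be attained; the factor `t > 1` avoids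
  -- compactness.
  obtain ⟨_, ⟨T, hT, rfl⟩, hlt⟩ := exists_lt_of_lt_csSup (s := S) ⟨_, T₀, hT₀, rfl⟩
    (div_lt_self hpos ht)
  refine ⟨T, hT, fun h0 => ?_, fun T' hT' => ?_⟩
  · simp only [h0, map_zero] at hlt
    exact absurd hlt (not_lt.mpr (by positivity))
  · refine (le_csSup hbdd ⟨T', hT', rfl⟩).trans ?_
    rw [div_lt_iff₀ (by positivity)] at hlt
    linarith

/-- An adapted matrix `T` bounds the minimal norm as soon as the matrices `T⁻¹ q T` are bounded. -/
lemma minimalNorm_le_of_conj {T : Matrix (Fin d) (Fin d) L} (hT : T.det ≠ 0) {c : ℝ} (hc : 0 ≤ c)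
    (hb : ∀ q ∈ Q, ∀ x, ν ((T⁻¹ * q * T).mulVec x) ≤ c * ν x) : minimalNorm ν Q ≤ c := by
  refine (minimalNorm_le ν Q (Matrix.GeneralLinearGroup.mkOfDetNeZero T hT)⁻¹).trans ?_
  refine setNorm_le hc ?_
  rintro _ ⟨q, hq, rfl⟩
  refine opNorm_le hc fun x => ?_
  have := hb q hq x
  simpa [Matrix.GeneralLinearGroup.mkOfDetNeZero] using this

end Generic

/-- Let `c` decrease to `max 1 R`, whose logarithm is `log⁺ R`. -/
lemma posLog_le_of_forall_le {E R B : ℝ} (hE : 0 ≤ E) (hR : 0 ≤ R) (hB : 1 ≤ B) (N : ℕ)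
    (h : ∀ c, max 1 R < c → E ≤ B * c ^ N) :
    Real.posLog E ≤ Real.log B + N * Real.posLog R := by
  have hm : 1 ≤ max 1 R := le_max_left _ _
  have hlim : Filter.Tendsto (fun c : ℝ => B * c ^ N) (nhdsWithin (max 1 R) (Set.Ioi (max 1 R)))
      (nhds (B * max 1 R ^ N)) :=
    ((continuous_const.mul (continuous_pow N)).tendsto _).mono_left nhdsWithin_le_nhds
  have hle : E ≤ B * max 1 R ^ N := ge_of_tendsto hlim (by
    filter_upwards [self_mem_nhdsWithin] with c hc using h c hc)
  have hBm : 1 ≤ B * max 1 R ^ N := one_le_mul_of_one_le_of_one_le hB (one_le_pow₀ hm)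
  calc Real.posLog E ≤ Real.posLog (B * max 1 R ^ N) := Real.posLog_le_posLog hE hle
    _ = Real.log B + N * Real.posLog R := by
      rw [Real.posLog_eq_log (by rwa [abs_of_pos (by positivity)]), Real.log_mul (by positivity)
        (by positivity), Real.log_pow, Real.posLog_eq_log_max_one hR]

/-! ### Nonarchimedean absolute values -/

section Ultrametric

variable {L : Type*} [Field L] {d : ℕ} {a : AbsoluteValue L ℝ}

lemma apply_le_supNorm (a : AbsoluteValue L ℝ) (x : Fin d → L) (i : Fin d) : a (x i) ≤ supNorm a x :=
  le_ciSup (Set.finite_range fun i => a (x i)).bddAbove i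

lemma supNorm_le {x : Fin d → L} {c : ℝ} (hc : 0 ≤ c) (h : ∀ i, a (x i) ≤ c) : supNorm a x ≤ c :=
  Real.iSup_le h hc

lemma supNorm_nonneg (a : AbsoluteValue L ℝ) (x : Fin d → L) : 0 ≤ supNorm a x :=
  Real.iSup_nonneg fun _ => a.nonneg _

lemma supNorm_add_le_max (hna : IsNonarchimedean a) (x y : Fin d → L) :
    supNorm a (x + y) ≤ max (supNorm a x) (supNorm a y) :=
  supNorm_le (le_max_of_le_left (supNorm_nonneg a x)) fun i =>
    (hna _ _).trans (max_le_max (apply_le_supNorm a x i) (apply_le_supNorm a y i))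

lemma isAbsNorm_supNorm (a : AbsoluteValue L ℝ) :
    IsAbsNorm a (supNorm a : (Fin d → L) → ℝ) where
  add_le x y := supNorm_le (add_nonneg (supNorm_nonneg a x) (supNorm_nonneg a y)) fun i =>
    (a.add_le _ _).trans (add_le_add (apply_le_supNorm a x i) (apply_le_supNorm a y i))
  smul c x := by
    simp only [supNorm, Pi.smul_apply, smul_eq_mul, map_mul]
    rw [Real.mul_iSup_of_nonneg (a.nonneg c)]
  single i := by
    refine le_antisymm (supNorm_le zero_le_one fun j => ?_) ?_
    · rcases eq_or_ne j i with rfl | hj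
      · simp
      · simp [hj]
    · simpa using apply_le_supNorm a (Pi.single i 1) i
  apply_le x i := apply_le_supNorm a x i
  nonneg x := supNorm_nonneg a x

lemma supNorm_mulVec_le (hna : IsNonarchimedean a) {A : Matrix (Fin d) (Fin d) L} {c : ℝ}
    (hc : 0 ≤ c) (hA : ∀ i j, a (A i j) ≤ c) (x : Fin d → L) :
    supNorm a (A.mulVec x) ≤ c * supNorm a x := by
  refine supNorm_le (mul_nonneg hc (supNorm_nonneg a x)) fun i => ?_
  rcases isEmpty_or_nonempty (Fin d) with he | he
  · exact he.elim i
  obtain ⟨j, -, hj⟩ := hna.finset_image_add (map_zero a) a.nonneg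
    (fun j => A i j * x j) Finset.univ
  refine hj.trans ?_
  rw [map_mul]
  exact mul_le_mul (hA i j) (apply_le_supNorm a x j) (a.nonneg _) hc

/-- The ultrametric inequality makes unit balls stable under addition; over `ℂ` only averages
survive, see `adapted_average`. -/
lemma adapted_add (hna : IsNonarchimedean a) {Q : Set (Matrix (Fin d) (Fin d) L)} {c : ℝ}
    {T T' : Matrix (Fin d) (Fin d) L} (hT : T ∈ adapted (supNorm a) Q c)
    (hT' : T' ∈ adapted (supNorm a) Q c) : T + T' ∈ adapted (supNorm a) Q c := by
  intro n p hp x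
  rw [Matrix.mul_add, Matrix.add_mulVec]
  exact (supNorm_add_le_max hna _ _).trans (max_le (hT n p hp x) (hT' n p hp x))

/-- Over an algebraically closed field, the value group of a nontrivial absolute value is dense. -/
lemma exists_apply_mem_Ioo [IsAlgClosed L] (hnt : ∃ x : L, 1 < a x) {r s : ℝ} (hr : 1 ≤ r)
    (hrs : r < s) : ∃ z : L, r < a z ∧ a z < s := by
  obtain ⟨x, hx⟩ := hnt
  have hb : 0 < Real.log (a x) := Real.log_pos hx
  have hr0 : 0 < r := by linarith
  have hx0 : 0 < a x := by linarith
  -- A rational `q` with `r < a(x)^q < s` is realized by a root of order `q.den` of `x ^ q.num`.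
  obtain ⟨q, hq1, hq2⟩ := exists_rat_btwn
    (div_lt_div_of_pos_right (Real.log_lt_log hr0 hrs) hb)
  have hq0 : (0 : ℝ) < q := (div_nonneg (Real.log_nonneg hr) hb.le).trans_lt hq1
  have hqn : (0 : ℚ) < q := by exact_mod_cast hq0
  obtain ⟨z, hz⟩ := IsAlgClosed.exists_pow_nat_eq (x ^ q.num.toNat) q.den_pos
  have hz' : a z = a x ^ (q : ℝ) := by
    have h1 : a z ^ q.den = a x ^ q.num.toNat := by rw [← map_pow, hz, map_pow]
    have h2 : ((q.num.toNat : ℕ) : ℝ) = (q : ℝ) * q.den := by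
      have h3 : ((q.num.toNat : ℕ) : ℤ) = q.num := Int.toNat_of_nonneg (Rat.num_pos.mpr hqn).le
      have h4 : (q : ℝ) * q.den = q.num := by exact_mod_cast Rat.mul_den_eq_num q
      rw [h4]; exact_mod_cast h3
    have h5 : a z ^ q.den = (a x ^ (q : ℝ)) ^ q.den := by
      rw [h1, ← Real.rpow_natCast, h2, Real.rpow_mul_natCast hx0.le]
    exact (pow_left_inj₀ (a.nonneg _) (by positivity) q.den_ne_zero).mp h5
  rw [div_lt_iff₀ hb] at hq1
  rw [lt_div_iff₀ hb] at hq2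
  refine ⟨z, ?_, ?_⟩
  · rw [hz', Real.rpow_def_of_pos hx0, ← Real.log_lt_iff_lt_exp hr0, mul_comm]
    exact hq1
  · rw [hz', Real.rpow_def_of_pos hx0, ← Real.lt_log_iff_exp_lt (by linarith), mul_comm]
    exact hq2

lemma exists_apply_le (hnt : ∃ x : L, 1 < a x) (ε : ℝ) (hε : 0 < ε) : ∃ μ : L, μ ≠ 0 ∧ a μ ≤ ε := by
  obtain ⟨x, hx⟩ := hnt
  have hx0 : x ≠ 0 := by rintro rfl; norm_num at hx
  obtain ⟨n, hn⟩ := exists_pow_lt_of_lt_one hε (inv_lt_one_of_one_lt₀ hx)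
  exact ⟨x⁻¹ ^ n, by positivity, by rw [map_pow, map_inv₀]; exact hn.le⟩

/-- Replacing the `i`-th column of an almost maximal adapted matrix `T` by the `j`-th column of
`T A` bounds the entries of `A`. -/
lemma apply_le_of_adapted (hna : IsNonarchimedean a) {Q : Set (Matrix (Fin d) (Fin d) L)} {c t : ℝ}
    (hc : 0 ≤ c) {T A : Matrix (Fin d) (Fin d) L} (hT : T ∈ adapted (supNorm a) Q c)
    (hT0 : T.det ≠ 0) (hmax : ∀ T' ∈ adapted (supNorm a) Q c, a T'.det ≤ t * a T.det)
    (hTA : T * A ∈ adapted (supNorm a) Q c) (i j : Fin d) : a (A i j) ≤ t := by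
  have hmem : T * (1 : Matrix (Fin d) (Fin d) L).updateCol i (A.col j) ∈
      adapted (supNorm a) Q c := by
    -- The new matrix is `T` with a column killed plus `T A` with one column moved; both right
    -- factors have entries 0 or 1, hence do not increase the sup norm.
    have : (1 : Matrix (Fin d) (Fin d) L).updateCol i (A.col j) =
        (1 : Matrix (Fin d) (Fin d) L).updateCol i 0 + A * Matrix.single j i 1 := by
      ext k l
      rcases eq_or_ne l i with rfl | hl
      · simp
      · simp [hl]
    rw [this, Matrix.mul_add, ← Matrix.mul_assoc]
    refine adapted_add hna (adapted_mul_right hc hT fun x => ?_)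
      (adapted_mul_right hc hTA fun x => ?_)
    · refine (supNorm_mulVec_le hna zero_le_one (fun k l => ?_) x).trans_eq (one_mul _)
      rw [Matrix.updateCol_apply]
      split_ifs
      · simp
      · rw [Matrix.one_apply]; split_ifs <;> simp
    · refine (supNorm_mulVec_le hna zero_le_one (fun k l => ?_) x).trans_eq (one_mul _)
      rw [Matrix.single_apply]; split_ifs <;> simp
  have h := hmax _ hmem
  have hdet : ((1 : Matrix (Fin d) (Fin d) L).updateCol i (A.col j)).det = A i j := by
    rw [← Matrix.cramer_apply, Matrix.cramer_one]; rfl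
  rw [Matrix.det_mul, hdet, map_mul, mul_comm] at h
  exact le_of_mul_le_mul_right h (a.pos hT0)

theorem posLog_minimalNorm_le_of_nonarchimedean [IsAlgClosed L] (hna : IsNonarchimedean a)
    (hnt : ∃ x : L, 1 < a x) (hd : 1 ≤ d) {Q : Set (Matrix (Fin d) (Fin d) L)} (hQ : Q.Finite)
    (hdet : ∀ q ∈ Q, q.det = 1) :
    Real.posLog (minimalNorm (supNorm a) Q) ≤ Real.posLog (jointSpectralRadius (supNorm a) Q) := by
  have hν := isAbsNorm_supNorm (d := d) a
  have key := posLog_le_of_forall_le (minimalNorm_nonneg (supNorm a) Q)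
    (hν.jointSpectralRadius_nonneg hd hQ hdet) le_rfl 1 fun c hc => ?_
  · simpa using key
  -- The parameter of the adapted norm must be a value `a z`, so that dividing by it is a scalar
  -- multiplication in `L`. The remaining slack `c / a z` serves as the tolerance `t` on the
  -- determinant.
  obtain ⟨z, hz1, hz2⟩ := exists_apply_mem_Ioo hnt (le_max_left _ _) hc
  have hz0 : 0 < a z := lt_of_lt_of_le zero_lt_one ((le_max_left _ _).trans hz1.le)
  have hzne : z ≠ 0 := a.pos_iff.mp hz0
  obtain ⟨T, hT, hT0, hmax⟩ := hν.exists_adapted_almost_maximal hd hQ hdet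
    ((le_max_right _ _).trans_lt hz1) (exists_apply_le hnt) ((one_lt_div hz0).mpr hz2)
  have hu : IsUnit T.det := isUnit_iff_ne_zero.mpr hT0
  rw [one_mul, pow_one]
  have hc0 : 0 ≤ c := hz0.le.trans hz2.le
  refine minimalNorm_le_of_conj hT0 hc0 fun q hq => supNorm_mulVec_le hna hc0 fun i j => ?_
  have hTA : T * (z⁻¹ • (T⁻¹ * q * T)) ∈ adapted (supNorm a) Q (a z) := by
    rw [Matrix.mul_smul, Matrix.mul_assoc, Matrix.mul_nonsing_inv_cancel_left _ _ hu]
    exact hν.adapted_smul_mul hT hq (by rw [map_inv₀, inv_mul_cancel₀ hz0.ne'])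
  have := apply_le_of_adapted hna hz0.le hT hT0 hmax hTA i j
  rw [Matrix.smul_apply, smul_eq_mul, map_mul, map_inv₀, inv_mul_le_iff₀ hz0,
    mul_div_cancel₀ _ hz0.ne'] at this
  exact this

end Ultrametric

/-! ### The complex absolute value -/

section Complex

variable {d : ℕ}

lemma euclNorm_eq_norm (x : Fin d → ℂ) :
    euclNorm (fun z : ℂ => ‖z‖) x = ‖WithLp.toLp 2 x‖ := by
  rw [EuclideanSpace.norm_eq, euclNorm]

lemma isAbsNorm_euclNorm :
    IsAbsNorm (NormedField.toAbsoluteValue ℂ)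
      (euclNorm (fun z : ℂ => ‖z‖) : (Fin d → ℂ) → ℝ) where
  add_le x y := by
    simp only [euclNorm_eq_norm, WithLp.toLp_add]
    exact norm_add_le _ _
  smul c x := by
    simp only [euclNorm_eq_norm, WithLp.toLp_smul]
    exact norm_smul _ _
  single i := by simp [euclNorm_eq_norm]
  apply_le x i := by
    rw [euclNorm_eq_norm]
    exact PiLp.norm_apply_le (WithLp.toLp 2 x) i
  nonneg x := Real.sqrt_nonneg _

lemma euclNorm_unitary_mulVec {U : Matrix (Fin d) (Fin d) ℂ} (hU : U ∈ Matrix.unitaryGroup (Fin d) ℂ)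
    (x : Fin d → ℂ) :
    euclNorm (fun z : ℂ => ‖z‖) (U.mulVec x) = euclNorm (fun z : ℂ => ‖z‖) x := by
  have key : ∀ y : Fin d → ℂ, ((∑ i, ‖y i‖ ^ 2 : ℝ) : ℂ) = star y ⬝ᵥ y := fun y => by
    simp [dotProduct, Complex.conj_mul']
  rw [euclNorm, euclNorm]
  congr 1
  have : ((∑ i, ‖U.mulVec x i‖ ^ 2 : ℝ) : ℂ) = ((∑ i, ‖x i‖ ^ 2 : ℝ) : ℂ) := by
    rw [key, key, Matrix.star_mulVec, Matrix.dotProduct_mulVec, Matrix.vecMul_vecMul,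
      ← Matrix.star_eq_conjTranspose, Matrix.mem_unitaryGroup_iff'.mp hU, Matrix.vecMul_one]
  exact_mod_cast this

lemma euclNorm_diagonal_mulVec_le {s : Fin d → ℝ} {M : ℝ} (hs : ∀ i, 0 ≤ s i) (hM : 0 ≤ M)
    (h : ∀ i, s i ≤ M) (x : Fin d → ℂ) :
    euclNorm (fun z : ℂ => ‖z‖) ((Matrix.diagonal fun i => (s i : ℂ)).mulVec x) ≤
      M * euclNorm (fun z : ℂ => ‖z‖) x := by
  rw [euclNorm, euclNorm, Real.sqrt_le_left (by positivity), mul_pow,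
    Real.sq_sqrt (by positivity), Finset.mul_sum]
  refine Finset.sum_le_sum fun i _ => ?_
  rw [Matrix.mulVec_diagonal, norm_mul, mul_pow, Complex.norm_real, Real.norm_eq_abs, sq_abs]
  have := hs i
  gcongr
  exact h i

lemma norm_det_unitary {U : Matrix (Fin d) (Fin d) ℂ} (hU : U ∈ Matrix.unitaryGroup (Fin d) ℂ) :
    ‖U.det‖ = 1 :=
  CStarRing.norm_of_mem_unitary (Matrix.det_of_mem_unitary hU)

open scoped ComplexOrder in
/-- The singular value decomposition of an invertible complex matrix. -/
lemma exists_singular_decomposition {A : Matrix (Fin d) (Fin d) ℂ} (hA : A.det ≠ 0) :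
    ∃ V ∈ Matrix.unitaryGroup (Fin d) ℂ, ∃ W ∈ Matrix.unitaryGroup (Fin d) ℂ, ∃ s : Fin d → ℝ,
      (∀ i, 0 < s i) ∧ A * W = V * Matrix.diagonal fun i => (s i : ℂ) := by
  have hu : IsUnit A.det := isUnit_iff_ne_zero.mpr hA
  have hpos : (A * A.conjTranspose).PosDef := Matrix.PosDef.mul_conjTranspose_self A
    (Matrix.vecMul_injective_of_isUnit ((Matrix.isUnit_iff_isUnit_det A).mpr hu))
  set V : Matrix (Fin d) (Fin d) ℂ := (hpos.1.eigenvectorUnitary).1 with hV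
  set s : Fin d → ℝ := fun i => √(hpos.1.eigenvalues i) with hs
  set D : Matrix (Fin d) (Fin d) ℂ := Matrix.diagonal fun i => (s i : ℂ) with hD
  have hspec : A * A.conjTranspose = V * (D * D) * V.conjTranspose := by
    conv_lhs => rw [hpos.1.spectral_theorem, Unitary.conjStarAlgAut_apply]
    rw [hD, Matrix.diagonal_mul_diagonal]
    congr 3
    ext i
    simp only [Function.comp_apply, hs]
    rw [← Complex.ofReal_mul, Real.mul_self_sqrt (hpos.eigenvalues_pos i).le]
    rfl
  have hDs : D.conjTranspose = D := by
    rw [hD, Matrix.diagonal_conjTranspose]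
    congr 1
    ext i
    simp
  -- From `A A* = V D² V*`, the matrix `A⁻¹ V D` is unitary.
  refine ⟨V, hpos.1.eigenvectorUnitary.2, A⁻¹ * (V * D), ?_, s,
    fun i => Real.sqrt_pos.mpr (hpos.eigenvalues_pos i),
    Matrix.mul_nonsing_inv_cancel_left _ _ hu⟩
  rw [Matrix.mem_unitaryGroup_iff, Matrix.star_eq_conjTranspose, Matrix.conjTranspose_mul,
    Matrix.conjTranspose_mul, hDs]
  calc A⁻¹ * (V * D) * (D * V.conjTranspose * A⁻¹.conjTranspose)
      = A⁻¹ * (V * (D * D) * V.conjTranspose) * A⁻¹.conjTranspose := by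
        simp only [Matrix.mul_assoc]
    _ = (A⁻¹ * A) * (A⁻¹ * A).conjTranspose := by
        rw [← hspec, Matrix.conjTranspose_mul]
        simp only [Matrix.mul_assoc]
    _ = 1 := by rw [Matrix.nonsing_inv_mul _ hu]; simp

/-- Positive numbers with product `P`, for which the product of the averages `(1 + s_i) / 2` is at
most `t`, are close to one if `t ^ 2 / P` is. -/
lemma sq_one_add_le_of_prod_le {s : Fin d → ℝ} (hs : ∀ i, 0 < s i) {t P : ℝ}
    (ht : ∏ i, ((1 + s i) / 2) ≤ t) (hP : ∏ i, s i = P) (j : Fin d) :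
    (1 + s j) ^ 2 ≤ 4 * s j * (t ^ 2 / P) := by
  have hP0 : 0 < P := hP ▸ Finset.prod_pos fun i _ => hs i
  -- By AM-GM each factor is at least 1, so a bound on the product bounds every single factor.
  have h1 : ∀ i, 1 ≤ ((1 + s i) / 2) ^ 2 / s i := fun i => by
    rw [one_le_div (hs i)]
    nlinarith [sq_nonneg (1 - s i)]
  have h2 : ((1 + s j) / 2) ^ 2 / s j ≤ ∏ i, (((1 + s i) / 2) ^ 2 / s i) := by
    rw [← Finset.mul_prod_erase _ _ (Finset.mem_univ j)]
    exact le_mul_of_one_le_right (zero_le_one.trans (h1 j))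
      (Finset.prod_const_one.symm.trans_le
        (Finset.prod_le_prod (fun _ _ => zero_le_one) fun i _ => h1 i))
  have h3 : ∏ i, (((1 + s i) / 2) ^ 2 / s i) ≤ t ^ 2 / P := by
    rw [Finset.prod_div_distrib, hP, Finset.prod_pow]
    refine div_le_div_of_nonneg_right (pow_le_pow_left₀ ?_ ht 2) hP0.le
    exact Finset.prod_nonneg fun i _ => by linarith [hs i]
  have h4 := (div_le_iff₀ (hs j)).mp (h2.trans h3)
  linarith

/-- The hypothesis reads `(s - 1)² ≤ 4 s (Y - 1)`. If `s > 1 + κ`, then `s / (s - 1) ≤ (1 + κ) / κ`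
turns it into a bound linear in `Y - 1`. Bernoulli trades this for a power of `Y`, so that the final
estimate is linear in `log c`. -/
lemma le_of_sq_one_add_le {s Y κ : ℝ} (hs : 0 < s) (hY : 1 ≤ Y) (hκ : 0 < κ)
    (h : (1 + s) ^ 2 ≤ 4 * s * Y) {B : ℕ} (hB : 4 / κ ≤ B) : s ≤ (1 + κ) * Y ^ B := by
  have hbern : 1 + B * (Y - 1) ≤ Y ^ B := by
    simpa using one_add_mul_le_pow (a := Y - 1) (by linarith) B
  have h4 : 4 / κ * (Y - 1) ≤ B * (Y - 1) := mul_le_mul_of_nonneg_right hB (by linarith)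
  have h5 : s ≤ (1 + κ) * (1 + 4 / κ * (Y - 1)) := by
    by_contra! hlt
    have hq : 0 ≤ 4 / κ * (Y - 1) := mul_nonneg (by positivity) (by linarith)
    have h6 : 1 + κ < s := by nlinarith
    have h7 : s * κ ≤ (s - 1) * (1 + κ) := by nlinarith
    have h8 : (s - 1) * κ ≤ 4 * (Y - 1) * (1 + κ) := by
      have : s * ((s - 1) * κ) ≤ s * (4 * (Y - 1) * (1 + κ)) := by
        nlinarith [mul_le_mul_of_nonneg_left h7 (by linarith : 0 ≤ s - 1)]
      exact le_of_mul_le_mul_left this hs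
    have h9 : s - 1 ≤ 4 / κ * (Y - 1) * (1 + κ) := by
      rw [← le_div_iff₀ hκ] at h8
      calc s - 1 ≤ _ := h8
        _ = _ := by ring
    nlinarith
  refine h5.trans (mul_le_mul_of_nonneg_left ?_ (by positivity))
  linarith

lemma adapted_average {Q : Set (Matrix (Fin d) (Fin d) ℂ)} {c : ℝ}
    {T T' : Matrix (Fin d) (Fin d) ℂ} (hT : T ∈ adapted (euclNorm (fun z : ℂ => ‖z‖)) Q c)
    (hT' : T' ∈ adapted (euclNorm (fun z : ℂ => ‖z‖)) Q c) :
    (1 / 2 : ℂ) • (T + T') ∈ adapted (euclNorm (fun z : ℂ => ‖z‖)) Q c := by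
  intro n p hp x
  have h1 := hT n p hp x
  have h2 := hT' n p hp x
  rw [Matrix.mul_smul, Matrix.smul_mulVec, isAbsNorm_euclNorm.smul, Matrix.mul_add,
    Matrix.add_mulVec]
  have h3 := isAbsNorm_euclNorm.add_le ((p * T).mulVec x) ((p * T').mulVec x)
  have h4 : (NormedField.toAbsoluteValue ℂ) (1 / 2 : ℂ) = 1 / 2 := by
    simp [NormedField.toAbsoluteValue]
  rw [h4]
  linarith

theorem exists_posLog_minimalNorm_le (hd : 1 ≤ d) {η : ℝ} (hη : 0 < η) :
    ∃ N : ℕ, ∀ Q : Set (Matrix (Fin d) (Fin d) ℂ), Q.Finite → (∀ q ∈ Q, q.det = 1) →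
      Real.posLog (minimalNorm (euclNorm (fun z : ℂ => ‖z‖)) Q) ≤
        η + N * Real.posLog (jointSpectralRadius (euclNorm (fun z : ℂ => ‖z‖)) Q) := by
  obtain ⟨B, hB⟩ := exists_nat_ge (4 / η)
  refine ⟨1 + (d + 1) * B, fun Q hQ hdet => ?_⟩
  set ν : (Fin d → ℂ) → ℝ := euclNorm (fun z : ℂ => ‖z‖) with hνdef
  have hν : IsAbsNorm (NormedField.toAbsoluteValue ℂ) ν := isAbsNorm_euclNorm
  refine (posLog_le_of_forall_le (B := 1 + η) (minimalNorm_nonneg ν Q)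
    (hν.jointSpectralRadius_nonneg hd hQ hdet) (by linarith) (1 + (d + 1) * B)
    fun c hc => ?_).trans (by gcongr; linarith [Real.log_le_sub_one_of_pos (by linarith : 0 < 1 + η)])
  have hc1 : 1 < c := (le_max_left _ _).trans_lt hc
  have hc0 : 0 < c := by linarith
  -- The tolerance is `√c`: it enters squared, and with `∏ sᵢ = c⁻ᵈ` gives `Y = c^(d+1)` below.
  obtain ⟨T, hT, hT0, hmax⟩ := hν.exists_adapted_almost_maximal hd hQ hdet
    ((le_max_right _ _).trans_lt hc)
    (exists_apply_le ⟨2, by simp [NormedField.toAbsoluteValue]⟩) (Real.lt_sqrt_of_sq_lt (by simpa))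
  change ∀ T' ∈ adapted ν Q c, ‖T'.det‖ ≤ √c * ‖T.det‖ at hmax
  have hu : IsUnit T.det := isUnit_iff_ne_zero.mpr hT0
  have hM : 0 ≤ (1 + η) * (c ^ (d + 1)) ^ B := by positivity
  have hgoal : (1 + η) * c ^ (1 + (d + 1) * B) = c * ((1 + η) * (c ^ (d + 1)) ^ B) := by ring
  rw [hgoal]
  refine minimalNorm_le_of_conj hT0 (by positivity) fun q hq x => ?_
  set A := (c⁻¹ : ℂ) • (T⁻¹ * q * T) with hAdef
  have hc' : (c : ℂ) ≠ 0 := by exact_mod_cast hc0.ne'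
  have hTA : T * A = (c⁻¹ : ℂ) • (q * T) := by
    rw [hAdef, Matrix.mul_smul, Matrix.mul_assoc, Matrix.mul_nonsing_inv_cancel_left _ _ hu]
  have hdetA : A.det = (c⁻¹ : ℂ) ^ d := by
    rw [hAdef, Matrix.det_smul, Fintype.card_fin, Matrix.mul_assoc, Matrix.det_mul,
      Matrix.det_mul, hdet q hq, one_mul, ← Matrix.det_mul, Matrix.nonsing_inv_mul _ hu,
      Matrix.det_one, mul_one]
  have hA0 : A.det ≠ 0 := by rw [hdetA]; exact pow_ne_zero _ (inv_ne_zero hc')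
  obtain ⟨V, hV, W, hW, s, hs, hAW⟩ := exists_singular_decomposition hA0
  set D : Matrix (Fin d) (Fin d) ℂ := Matrix.diagonal fun i => (s i : ℂ) with hD
  -- Up to unitary factors on the right, these are `T` and `c⁻¹ q T`. In these bases they differ by
  -- the positive diagonal matrix `D`, so the determinant of their average is explicit.
  have hmem1 : T * V ∈ adapted ν Q c :=
    adapted_mul_right hc0.le hT fun x => (euclNorm_unitary_mulVec hV x).le
  have hmem2 : T * (V * D) ∈ adapted ν Q c := by
    rw [← hAW, ← Matrix.mul_assoc, hTA]
    refine adapted_mul_right hc0.le (hν.adapted_smul_mul hT hq ?_)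
      fun x => (euclNorm_unitary_mulVec hW x).le
    simp [NormedField.toAbsoluteValue, abs_of_pos hc0, hc0.ne']
  have havg : (1 / 2 : ℂ) • (T * V + T * (V * D)) =
      T * V * Matrix.diagonal fun i => (((1 + s i) / 2 : ℝ) : ℂ) := by
    have : (Matrix.diagonal fun i => (((1 + s i) / 2 : ℝ) : ℂ)) = (1 / 2 : ℂ) • (1 + D) := by
      rw [hD, ← Matrix.diagonal_one, Matrix.diagonal_add, ← Matrix.diagonal_smul]
      congr 1
      ext i
      simp only [Pi.smul_apply, smul_eq_mul]
      push_cast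
      ring
    rw [this, Matrix.mul_smul, Matrix.mul_add, Matrix.mul_one, Matrix.mul_assoc]
  have hnp : ∀ r : Fin d → ℝ, (∀ i, 0 < r i) → ‖∏ i, (r i : ℂ)‖ = ∏ i, r i := fun r hr => by
    rw [norm_prod]
    exact Finset.prod_congr rfl fun i _ => by
      rw [Complex.norm_real, Real.norm_eq_abs, abs_of_pos (hr i)]
  have hprod1 : ∏ i, ((1 + s i) / 2) ≤ √c := by
    have := hmax _ (adapted_average hmem1 hmem2)
    rw [havg, Matrix.det_mul, Matrix.det_mul, norm_mul, norm_mul, norm_det_unitary hV, mul_one,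
      Matrix.det_diagonal, hnp _ (fun i => by linarith [hs i]), mul_comm] at this
    exact le_of_mul_le_mul_right this (norm_pos_iff.mpr hT0)
  -- This uses `det q = 1`: the competitor loses only the factor `cᵈ` in determinant.
  have hprod2 : ∏ i, s i = (c ^ d)⁻¹ := by
    have := congrArg (fun M : Matrix (Fin d) (Fin d) ℂ => ‖M.det‖) hAW
    simp only [Matrix.det_mul, norm_mul, norm_det_unitary hV, norm_det_unitary hW] at this
    rw [hD, Matrix.det_diagonal, hnp _ hs, hdetA] at this
    simpa [abs_of_pos hc0] using this.symm
  have hsle : ∀ i, s i ≤ (1 + η) * (c ^ (d + 1)) ^ B := fun i => by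
    refine le_of_sq_one_add_le (hs i) (one_le_pow₀ hc1.le) hη ?_ hB
    have := sq_one_add_le_of_prod_le hs hprod1 hprod2 i
    rwa [Real.sq_sqrt hc0.le, div_inv_eq_mul, ← pow_succ'] at this
  have hA : A = V * D * star W := by
    rw [← hAW, Matrix.mul_assoc, Matrix.mem_unitaryGroup_iff.mp hW, Matrix.mul_one]
  have hconj : T⁻¹ * q * T = (c : ℂ) • (V * D * star W) := by
    rw [← hA, hAdef, smul_smul, mul_inv_cancel₀ hc', one_smul]
  rw [hconj, Matrix.smul_mulVec, hν.smul, ← Matrix.mulVec_mulVec, ← Matrix.mulVec_mulVec,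
    mul_assoc]
  have hnc : NormedField.toAbsoluteValue ℂ (c : ℂ) = c := by
    simp [NormedField.toAbsoluteValue, abs_of_pos hc0]
  rw [hnc]
  refine mul_le_mul_of_nonneg_left ?_ hc0.le
  calc ν (V.mulVec (D.mulVec ((star W).mulVec x))) = ν (D.mulVec ((star W).mulVec x)) :=
        euclNorm_unitary_mulVec hV _
    _ ≤ (1 + η) * (c ^ (d + 1)) ^ B * ν ((star W).mulVec x) :=
        euclNorm_diagonal_mulVec_le (fun i => (hs i).le) hM hsle _
    _ = (1 + η) * (c ^ (d + 1)) ^ B * ν x := by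
        rw [hνdef, euclNorm_unitary_mulVec (Unitary.star_mem hW)]

end Complex

/-! ### Finite places -/

section FinitePlaces

open NumberField IsDedekindDomain

/-- Over a complete ultrametric field the spectral norm is multiplicative and ultrametric; since `x
↦ x ^ r` is increasing and multiplicative on `[0, ∞)`, both properties survive for every `r > 0`,
even `r > 1`. -/
lemma exists_absoluteValue_eq_spectralNorm_rpow (k Ω : Type*) [NormedField k] [CompleteSpace k]
    [IsUltrametricDist k] (hk : ∃ x : k, 1 < ‖x‖) [Field Ω] [Algebra k Ω] [Algebra.IsAlgebraic k Ω]
    {r : ℝ} (hr : 0 < r) :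
    ∃ a : AbsoluteValue Ω ℝ, (∀ x, a x = spectralNorm k Ω x ^ r) ∧ IsNonarchimedean a ∧
      ∃ x, 1 < a x := by
  let _ : NontriviallyNormedField k := { (inferInstance : NormedField k) with non_trivial := hk }
  have hna : IsNonarchimedean fun x : Ω => spectralNorm k Ω x ^ r := fun x y => by
    have h0 := fun x : Ω => spectralNorm_nonneg (K := k) x
    rw [← (Real.monotoneOn_rpow_Ici_of_exponent_nonneg hr.le).map_max (h0 x) (h0 y)]
    exact Real.rpow_le_rpow (h0 _) (isNonarchimedean_spectralNorm x y) hr.le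
  refine ⟨{ toFun := fun x => spectralNorm k Ω x ^ r
            map_mul' := fun x y => ?_
            nonneg' := fun x => Real.rpow_nonneg (spectralNorm_nonneg x) r
            eq_zero' := fun x => ?_
            add_le' := fun x y => ?_ }, fun _ => rfl, hna, ?_⟩
  · rw [← Real.mul_rpow (spectralNorm_nonneg x) (spectralNorm_nonneg y)]
    congr 1
    exact spectralAlgNorm_mul x y
  · rw [Real.rpow_eq_zero (spectralNorm_nonneg x) hr.ne']
    exact ⟨fun h => eq_zero_of_map_spectralNorm_eq_zero h (Algebra.IsAlgebraic.isAlgebraic x),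
      fun h => by rw [h, spectralNorm_zero]⟩
  · exact (hna x y).trans (max_le_add_of_nonneg (Real.rpow_nonneg (spectralNorm_nonneg x) r)
      (Real.rpow_nonneg (spectralNorm_nonneg y) r))
  · obtain ⟨x, hx⟩ := hk
    refine ⟨algebraMap k Ω x, ?_⟩
    change 1 < spectralNorm k Ω (algebraMap k Ω x) ^ r
    rw [spectralNorm_extends]
    exact Real.one_lt_rpow hx hr

variable (K : Type*) [Field K] [NumberField K]

lemma exists_one_lt_norm_adicCompletion (v : HeightOneSpectrum (𝓞 K)) :
    ∃ x : v.adicCompletion K, 1 < ‖x‖ := by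
  obtain ⟨x, hx, hx0⟩ := Submodule.exists_mem_ne_zero_of_ne_bot v.ne_bot
  refine ⟨(FinitePlace.embedding v (algebraMap (𝓞 K) K x))⁻¹, ?_⟩
  rw [norm_inv]
  refine one_lt_inv_iff₀.mpr ⟨norm_pos_iff.mpr ?_, (FinitePlace.norm_lt_one_iff_mem K v x).mpr hx⟩
  simpa using hx0

lemma exists_absoluteValue_eq_finiteAbs (v : HeightOneSpectrum (𝓞 K)) (hv : localDegree K v ≠ 0) :
    ∃ a : AbsoluteValue (CompletionClosure K v) ℝ, (a : CompletionClosure K v → ℝ) = finiteAbs K v ∧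
      IsNonarchimedean a ∧ ∃ x, 1 < a x := by
  obtain ⟨a, ha, ha'⟩ := exists_absoluteValue_eq_spectralNorm_rpow (v.adicCompletion K)
    (CompletionClosure K v) (exists_one_lt_norm_adicCompletion K v)
    (r := 1 / (localDegree K v : ℝ)) (by positivity)
  exact ⟨a, funext ha, ha'⟩

end FinitePlaces

/-! ### Comparison of the heights -/

section Comparison

open NumberField IsDedekindDomain

lemma det_eq_one_of_mem_mapSet {K L : Type*} [Field K] [Field L] {d : ℕ}
    {F : Set (Matrix (Fin d) (Fin d) K)} (σ : K →+* L) (hF : ∀ A ∈ F, A.det = 1) :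
    ∀ q ∈ mapSet σ F, q.det = 1 := by
  rintro _ ⟨A, hA, rfl⟩
  have := σ.map_det A
  rw [hF A hA, map_one] at this
  exact this.symm

lemma finite_mapSet {K L : Type*} [Field K] [Field L] {d : ℕ}
    {F : Set (Matrix (Fin d) (Fin d) K)} (σ : K →+* L) (hF : F.Finite) : (mapSet σ F).Finite :=
  hF.image _

lemma posLog_spectralRadiusInfinite_le {K : Type*} [Field K] {d : ℕ}
    {F : Set (Matrix (Fin d) (Fin d) K)} (hd : 1 ≤ d) (hF : F.Finite) (hdet : ∀ A ∈ F, A.det = 1) (v : InfinitePlace K) :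
    Real.posLog (spectralRadiusInfinite v F) ≤ Real.posLog (minimalNormInfinite v F) := by
  have hfin := finite_mapSet v.embedding hF
  have hdet' := det_eq_one_of_mem_mapSet v.embedding hdet
  exact Real.posLog_le_posLog (isAbsNorm_euclNorm.jointSpectralRadius_nonneg hd hfin hdet')
    (isAbsNorm_euclNorm.jointSpectralRadius_le_minimalNorm hd hfin hdet')

variable {K : Type*} [Field K] [NumberField K] {d : ℕ} {F : Set (Matrix (Fin d) (Fin d) K)}

/-- At a finite place the minimal norm and the spectral radius contribute equally. -/
lemma localDegree_mul_posLog_eq (hd : 1 ≤ d) (hF : F.Finite) (hdet : ∀ A ∈ F, A.det = 1)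
    (v : HeightOneSpectrum (𝓞 K)) :
    (localDegree K v : ℝ) * Real.posLog (minimalNormFinite v F) =
      (localDegree K v : ℝ) * Real.posLog (spectralRadiusFinite v F) := by
  -- If `finrank` took its default value 0, the terms on both sides would vanish, so finiteness of
  -- the local degree is not needed.
  rcases eq_or_ne (localDegree K v) 0 with h0 | h0
  · simp [h0]
  obtain ⟨a, ha, hna, hnt⟩ := exists_absoluteValue_eq_finiteAbs K v h0
  have hfin := finite_mapSet (finiteEmbedding K v) hF
  have hdet' := det_eq_one_of_mem_mapSet (finiteEmbedding K v) hdet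
  rw [minimalNormFinite, spectralRadiusFinite, ← ha]
  congr 1
  refine le_antisymm (posLog_minimalNorm_le_of_nonarchimedean hna hnt hd hfin hdet') ?_
  exact Real.posLog_le_posLog ((isAbsNorm_supNorm a).jointSpectralRadius_nonneg hd hfin hdet')
    ((isAbsNorm_supNorm a).jointSpectralRadius_le_minimalNorm hd hfin hdet')

theorem normalizedHeight_nonneg (F : Set (Matrix (Fin d) (Fin d) K)) : 0 ≤ normalizedHeight F :=
  mul_nonneg (by positivity) (add_nonneg
    (Finset.sum_nonneg fun _ _ => mul_nonneg (Nat.cast_nonneg _) Real.posLog_nonneg)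
    (finsum_nonneg fun _ => mul_nonneg (Nat.cast_nonneg _) Real.posLog_nonneg))

theorem normalizedHeight_le_minimalHeight (hd : 1 ≤ d) (hF : F.Finite)
    (hdet : ∀ A ∈ F, A.det = 1) : normalizedHeight F ≤ minimalHeight F := by
  rw [normalizedHeight, minimalHeight]
  -- The sums over finite places agree term by term, so finiteness of their support plays no role.
  refine mul_le_mul_of_nonneg_left (add_le_add (Finset.sum_le_sum fun v _ => ?_)
    (finsum_congr fun v => (localDegree_mul_posLog_eq hd hF hdet v).symm).le) (by positivity)
  exact mul_le_mul_of_nonneg_left (posLog_spectralRadiusInfinite_le hd hF hdet v)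
    (Nat.cast_nonneg _)

/-- The minimal height is controlled by the normalized height, uniformly in the number field. -/
theorem exists_minimalHeight_le (hd : 1 ≤ d) {η : ℝ} (hη : 0 < η) :
    ∃ C : ℝ, 0 < C ∧ ∀ (K : Type) [Field K] [NumberField K] (F : Set (Matrix (Fin d) (Fin d) K)),
      F.Finite → (∀ A ∈ F, A.det = 1) → minimalHeight F ≤ η + C * normalizedHeight F := by
  obtain ⟨N, hN⟩ := exists_posLog_minimalNorm_le hd hη
  refine ⟨N + 1, by positivity, fun K _ _ F hF hdet => ?_⟩
  set n : ℝ := (Module.finrank ℚ K : ℝ) with hn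
  have hn0 : 0 < n := by rw [hn]; exact_mod_cast Module.finrank_pos
  set S := ∑ v : InfinitePlace K, (v.mult : ℝ) * Real.posLog (spectralRadiusInfinite v F) with hS
  have hS0 : 0 ≤ S :=
    Finset.sum_nonneg fun _ _ => mul_nonneg (Nat.cast_nonneg _) Real.posLog_nonneg
  set P := ∑ᶠ v : HeightOneSpectrum (𝓞 K),
    (localDegree K v : ℝ) * Real.posLog (spectralRadiusFinite v F) with hP
  have hP0 : 0 ≤ P := finsum_nonneg fun _ => mul_nonneg (Nat.cast_nonneg _) Real.posLog_nonneg
  have hinf : ∑ v : InfinitePlace K, (v.mult : ℝ) * Real.posLog (minimalNormInfinite v F) ≤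
      η * n + N * S := by
    -- The error `η` per infinite place, weighted by local degrees, totals `η [K : ℚ]`;
    -- normalization makes it `η` for every `K`.
    have hmult : ∑ v : InfinitePlace K, (v.mult : ℝ) = n := by
      rw [hn, ← InfinitePlace.sum_mult_eq, Nat.cast_sum]
    rw [← hmult, hS, Finset.mul_sum, Finset.mul_sum, ← Finset.sum_add_distrib]
    refine Finset.sum_le_sum fun v _ => ?_
    have := hN _ (finite_mapSet v.embedding hF) (det_eq_one_of_mem_mapSet v.embedding hdet)
    calc (v.mult : ℝ) * Real.posLog (minimalNormInfinite v F)
        ≤ (v.mult : ℝ) * (η + N * Real.posLog (spectralRadiusInfinite v F)) :=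
          mul_le_mul_of_nonneg_left this (Nat.cast_nonneg _)
      _ = _ := by ring
  have hfin : ∑ᶠ v : HeightOneSpectrum (𝓞 K),
      (localDegree K v : ℝ) * Real.posLog (minimalNormFinite v F) = P :=
    finsum_congr fun v => localDegree_mul_posLog_eq hd hF hdet v
  have hN0 : (0 : ℝ) ≤ N := Nat.cast_nonneg N
  rw [minimalHeight, normalizedHeight, hfin]
  calc 1 / n * (_ + P) ≤ 1 / n * (η * n + (N + 1) * (S + P)) := by
        refine mul_le_mul_of_nonneg_left ?_ (by positivity)
        nlinarith [mul_nonneg hN0 hP0]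
    _ = η + (N + 1) * (1 / n * (S + P)) := by field_simp

end Comparison

/-! ### Passage from `SL_d` of the algebraic numbers to matrices over `K` -/

variable {d : ℕ} {K : IntermediateField ℚ Qbar} {F : Set (Matrix.SpecialLinearGroup (Fin d) Qbar)}

lemma finite_overField (hF : F.Finite) : (overField K F).Finite := by
  refine Set.Finite.subset ((hF.image fun g : Matrix.SpecialLinearGroup (Fin d) Qbar => g.1).preimage
    (Matrix.map_injective (algebraMap K Qbar).injective).injOn) ?_
  rintro A ⟨g, hg, hA⟩
  exact ⟨g, hg, hA.symm⟩

lemma det_eq_one_of_mem_overField : ∀ A ∈ overField K F, A.det = 1 := by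
  rintro A ⟨g, -, hA⟩
  apply (algebraMap K Qbar).injective
  rw [RingHom.map_det, RingHom.mapMatrix_apply, hA, map_one]
  exact g.2

end HeightGap

end

theorem mainTheorem11 (d : ℕ) (hd : 1 ≤ d) :
    (∀ ε : ℝ, 0 < ε → ∃ δ : ℝ, 0 < δ ∧
      ∀ (F : Set (Matrix.SpecialLinearGroup (Fin d) HeightGap.Qbar)), F.Finite →
      ∀ (K : IntermediateField ℚ HeightGap.Qbar) [NumberField K], HeightGap.DefinedOver K F →
        HeightGap.normalizedHeight (HeightGap.overField K F) < δ →
        HeightGap.minimalHeight (HeightGap.overField K F) < ε) ∧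
    (∀ (F : Set (Matrix.SpecialLinearGroup (Fin d) HeightGap.Qbar)), F.Finite →
      ∀ (K : IntermediateField ℚ HeightGap.Qbar) [NumberField K], HeightGap.DefinedOver K F →
        (HeightGap.normalizedHeight (HeightGap.overField K F) = 0 ↔
          HeightGap.minimalHeight (HeightGap.overField K F) = 0)) := by
  have small : ∀ ε : ℝ, 0 < ε → ∃ δ : ℝ, 0 < δ ∧
      ∀ (F : Set (Matrix.SpecialLinearGroup (Fin d) HeightGap.Qbar)), F.Finite →
      ∀ (K : IntermediateField ℚ HeightGap.Qbar) [NumberField K],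
        HeightGap.normalizedHeight (HeightGap.overField K F) < δ →
        HeightGap.minimalHeight (HeightGap.overField K F) < ε := by
    intro ε hε
    obtain ⟨C, hC, h⟩ := HeightGap.exists_minimalHeight_le hd (half_pos hε)
    -- From `e ≤ ε/2 + C ĥ`, the bound `ĥ < ε/(2C)` suffices.
    refine ⟨ε / 2 / C, by positivity, fun F hF K _ hlt => ?_⟩
    have h1 := h K _ (HeightGap.finite_overField hF) HeightGap.det_eq_one_of_mem_overField
    rw [lt_div_iff₀ hC] at hlt
    linarith
  refine ⟨fun ε hε => ?_, fun F hF K _ _ => ?_⟩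
  · obtain ⟨δ, hδ, h⟩ := small ε hε
    exact ⟨δ, hδ, fun F hF K _ _ => h F hF K⟩
  · have hle := HeightGap.normalizedHeight_le_minimalHeight hd
      (HeightGap.finite_overField (K := K) hF) HeightGap.det_eq_one_of_mem_overField
    have hnonneg := HeightGap.normalizedHeight_nonneg (HeightGap.overField K F)
    refine ⟨fun h0 => le_antisymm (le_of_forall_pos_lt_add fun ε hε => ?_) (hnonneg.trans hle),
      fun h0 => le_antisymm (hle.trans h0.le) hnonneg⟩
    obtain ⟨δ, hδ, h⟩ := small ε hε
    rw [zero_add]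
    exact h F hF K (by rwa [h0])
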